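/- All graphs are finite and simple. A family $H_1,\dots,H_k$ of subgraphs of a graph $G$ \emph{covers} $G$ if every edge of $G$ is an edge of at least one $H_i$. A \emph{pseudoforest} is a graph with at most one cycle per connected component, and a \emph{star forest} is a forest without paths of length $3$ (that is, a disjoint union of stars). Let the pseudoarboricity $p(G)$ be the minimum $k$ such that $G$ is covered by $k$ subgraphs that are pseudoforests; let the arboricity $a(G)$ be the minimum $k$ such that $G$ is covered by $k$ subgraphs that are forests; and let the local star arboricity $\mathrm{sa}_\ell(G)$ be the minimum $j$ such that $G$ is covered by some finite family $H_1,\dots,H_k$ of subgraphs ($k$ arbitrary), each of which is a star forest, with every vertex of $G$ contained in $H_i$ for at most $j$ indices $i$. \textbf{Theorem.} For every graph $G$, $$p(G)\le a(G)\le \mathrm{sa}_\ell(G)\le p(G)+1,$$ and each of the three inequalities is strict for some graph $G$. Moreover, for every graph $G$, $\mathrm{sa}_\ell(G)=p(G)$ if and only if $G$ has an orientation whose maximum out-degree equals $p(G)$ and in which every vertex of out-degree $p(G)$ has degree $p(G)$ in $G$. (The maximum out-degree of the graph without vertices is $0$.) -/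

import Mathlib

/-! Covers of graphs by template graphs, the covering numbers built on them, and orientations. -/

universe u

namespace GraphCover

/-- A template class: a property of (simple) graphs. -/
abbrev TemplateClass := ∀ ⦃W : Type u⦄, SimpleGraph W → Prop

/-- The forests: graphs without cycles. -/
def Forest : TemplateClass.{u} := fun _ T => T.IsAcyclic

/-- The pseudoforests: graphs with at most one cycle per connected component. Two closed walks
that are cycles are the same cycle of the graph when they run through the same edges. -/
def Pseudoforest : TemplateClass.{u} := fun W T =>
  ∀ (u v : W) (c : T.Walk u u) (d : T.Walk v v),
    c.IsCycle → d.IsCycle → T.Reachable u v → ∀ e : Sym2 W, e ∈ c.edges ↔ e ∈ d.edges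

/-- The star forests: forests without paths of length 3. -/
def StarForest : TemplateClass.{u} := fun W T =>
  T.IsAcyclic ∧ ∀ (u v : W) (q : T.Walk u v), q.IsPath → q.length ≠ 3

variable {V : Type u}

/-- `H 0, …, H (k - 1)` is an injective cover of `G` of size `k` with respect to `𝒯`: each `H i`
is a subgraph of `G` (the image of a template graph under an injective homomorphism) which, as a
graph on its own vertex set, belongs to `𝒯`, and every edge of `G` is an edge of some `H i`. -/
def IsInjectiveCover (𝒯 : TemplateClass.{u}) (G : SimpleGraph V) {k : ℕ}
    (H : Fin k → G.Subgraph) : Prop :=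
  (∀ i, 𝒯 (H i).coe) ∧ ∀ u v, G.Adj u v → ∃ i, (H i).Adj u v

/-- The global covering number: the least size of an injective cover of `G`. -/
noncomputable def globalCoveringNumber (𝒯 : TemplateClass.{u}) (G : SimpleGraph V) : ℕ :=
  sInf {k | ∃ H : Fin k → G.Subgraph, IsInjectiveCover 𝒯 G H}

/-- The local covering number: the least `j` such that `G` has an injective cover, of any size,
in which every vertex lies in at most `j` of the template graphs. -/
noncomputable def localCoveringNumber (𝒯 : TemplateClass.{u}) (G : SimpleGraph V) : ℕ :=
  sInf {j | ∃ (k : ℕ) (H : Fin k → G.Subgraph), IsInjectiveCover 𝒯 G H ∧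
    ∀ v, {i | v ∈ (H i).verts}.ncard ≤ j}

/-- The pseudoarboricity `p(G)`. -/
noncomputable def pseudoarboricity (G : SimpleGraph V) : ℕ := globalCoveringNumber Pseudoforest G

/-- The arboricity `a(G)`. -/
noncomputable def arboricity (G : SimpleGraph V) : ℕ := globalCoveringNumber Forest G

/-- The local star arboricity `sa_ℓ(G)`. -/
noncomputable def localStarArboricity (G : SimpleGraph V) : ℕ := localCoveringNumber StarForest G

/-- `D` is an orientation of `G`: every edge of `G` is directed in exactly one of the two possible
ways, and `D` has no other arcs. -/
def IsOrientation (D : Digraph V) (G : SimpleGraph V) : Prop :=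
  (∀ u v, G.Adj u v ↔ D.Adj u v ∨ D.Adj v u) ∧ ∀ u v, D.Adj u v → ¬ D.Adj v u

/-- The out-degree of a vertex. -/
noncomputable def outDegree (D : Digraph V) (v : V) : ℕ := {w | D.Adj v w}.ncard

/-- The maximum out-degree (`0` if there are no vertices). -/
noncomputable def maxOutDegree [Fintype V] (D : Digraph V) : ℕ := Finset.univ.sup (outDegree D)

end GraphCover

/-!
Everything is expressed through orientations.

* `G` is covered by `k` pseudoforests iff it has an orientation with all out-degrees at most `k`.
  A pseudoforest has an orientation with out-degrees at most `1`
  (`Pseudoforest.exists_orientation`), and these orientations add up over a cover. Conversely, the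
  arcs leaving each vertex get different colours, and a graph oriented with out-degrees at most `1`
  is a pseudoforest (`IsFunctional.pseudoforest`).
* `G` has a star forest cover with at most `k` members at each vertex iff it has an orientation
  with out-degrees at most `k` in which the vertices of out-degree `k` have degree `k`. Given the
  cover, orient edges from leaves to centres (`exists_orientation_of_starForest_cover`); given the
  orientation, take the stars formed by a vertex and its in-neighbours
  (`exists_starForest_cover_of_orientation`).

An orientation with out-degrees at most `p(G)` satisfies the second condition for `k = p(G) + 1`
vacuously, which gives `sa_ℓ(G) ≤ p(G) + 1`, and the second condition for `k = p(G)` is the stated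
characterization of equality. Forests are pseudoforests, so `p(G) ≤ a(G)`.

The inequality `a(G) ≤ sa_ℓ(G)` turns a local cover into a global one. By Nash-Williams' theorem
(`exists_forest_cover`) it suffices that every nonempty vertex set `U` induces at most
`sa_ℓ(G) (|U| - 1)` edges, and a double count of the star cover shows this
(`ncard_edgesWithin_le_of_starForest_cover`). Nash-Williams' theorem is proved by the augmenting
path argument of matroid partition: a partial colouring of the edges by forests is enlarged along a
shortest walk of exchanges (`exists_augmentation`), and if no such walk exists, the edges reachable
by exchanges violate the sparsity condition (`exists_reach_isFree`).
-/

namespace GraphCover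

open SimpleGraph

variable {V : Type u}

/-! ### Nash-Williams' theorem -/

/-- The closure of a set `A` of edges in the graphic matroid: the pairs whose two ends are joined
by a walk with all edges in `A`. It also contains all pairs with equal ends, the loops. -/
def edgeSpan (A : Set (Sym2 V)) : Set (Sym2 V) :=
  Sym2.fromRel (r := (fromEdgeSet A).Reachable) ⟨fun _ _ h => h.symm⟩

lemma mk_mem_edgeSpan {A : Set (Sym2 V)} {u v : V} :
    s(u, v) ∈ edgeSpan A ↔ (fromEdgeSet A).Reachable u v := Iff.rfl

lemma edgeSpan_mono {A B : Set (Sym2 V)} (h : A ⊆ B) : edgeSpan A ⊆ edgeSpan B := by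
  rintro ⟨u, v⟩ he
  exact Reachable.mono (fromEdgeSet_mono h) he

lemma subset_edgeSpan (A : Set (Sym2 V)) : A ⊆ edgeSpan A := by
  rintro ⟨u, v⟩ he
  by_cases huv : u = v
  · subst huv
    exact Reachable.refl (G := fromEdgeSet A) u
  · exact Adj.reachable (G := fromEdgeSet A) ((fromEdgeSet_adj A).2 ⟨he, huv⟩)

lemma reachable_of_subset_edgeSpan {A B : Set (Sym2 V)} (h : B ⊆ edgeSpan A) {u v : V}
    (huv : (fromEdgeSet B).Reachable u v) : (fromEdgeSet A).Reachable u v := by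
  obtain ⟨p⟩ := huv
  induction p with
  | nil => exact Reachable.refl _
  | cons hadj _ ih => exact Reachable.trans (h ((fromEdgeSet_adj B).1 hadj).1) ih

lemma edgeSpan_subset {A B : Set (Sym2 V)} (h : B ⊆ edgeSpan A) : edgeSpan B ⊆ edgeSpan A := by
  rintro ⟨u, v⟩ he
  exact reachable_of_subset_edgeSpan h he

/-- The exchange property of the closure operator. -/
lemma mem_edgeSpan_insert_exchange {B : Set (Sym2 V)} {f h : Sym2 V}
    (hf : f ∈ edgeSpan (insert h B)) (hf' : f ∉ edgeSpan B) : h ∈ edgeSpan (insert f B) := by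
  induction f with | _ x y
  induction h with | _ a b
  -- A walk from `x` to `y` either avoids `s(a, b)` or has a first and a last passage through it.
  have key : ∀ {x y : V}, (fromEdgeSet (insert s(a, b) B)).Reachable x y →
      (fromEdgeSet B).Reachable x y ∨
      ((fromEdgeSet B).Reachable x a ∧ (fromEdgeSet B).Reachable b y) ∨
      ((fromEdgeSet B).Reachable x b ∧ (fromEdgeSet B).Reachable a y) := by
    rintro x y ⟨p⟩
    induction p with
    | nil => exact Or.inl (Reachable.refl _)
    | @cons u v w hadj _ ih =>
      obtain ⟨h1, h2⟩ := (fromEdgeSet_adj _).1 hadj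
      rcases h1 with h1 | h1
      · rcases Sym2.eq_iff.1 h1 with ⟨rfl, rfl⟩ | ⟨rfl, rfl⟩
        · rcases ih with h | ⟨h, h'⟩ | ⟨h, h'⟩
          · exact Or.inr (Or.inl ⟨Reachable.refl _, h⟩)
          · exact Or.inr (Or.inl ⟨Reachable.refl _, h'⟩)
          · exact Or.inl h'
        · rcases ih with h | ⟨h, h'⟩ | ⟨h, h'⟩
          · exact Or.inr (Or.inr ⟨Reachable.refl _, h⟩)
          · exact Or.inl h'
          · exact Or.inr (Or.inr ⟨Reachable.refl _, h'⟩)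
      · have huv : (fromEdgeSet B).Reachable u v :=
          Adj.reachable ((fromEdgeSet_adj _).2 ⟨h1, h2⟩)
        rcases ih with h | ⟨h, h'⟩ | ⟨h, h'⟩
        · exact Or.inl (huv.trans h)
        · exact Or.inr (Or.inl ⟨huv.trans h, h'⟩)
        · exact Or.inr (Or.inr ⟨huv.trans h, h'⟩)
  have hxy : (fromEdgeSet (insert s(x, y) B)).Reachable x y :=
    mk_mem_edgeSpan.1 (subset_edgeSpan _ (Set.mem_insert _ _))
  have hB : fromEdgeSet B ≤ fromEdgeSet (insert s(x, y) B) :=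
    fromEdgeSet_mono (Set.subset_insert _ _)
  rw [mk_mem_edgeSpan] at hf hf' ⊢
  rcases key hf with h | ⟨h, h'⟩ | ⟨h, h'⟩
  · exact absurd h hf'
  · exact ((h.mono hB).symm.trans hxy).trans (h'.mono hB).symm
  · exact ((h'.mono hB).trans hxy.symm).trans (h.mono hB)

/-- If the removal of `g` from `A` separates the ends of `f`, which `A` joins, then it still does
so after the addition of an edge outside the span of `A`. -/
lemma notMem_edgeSpan_insert_diff {A : Set (Sym2 V)} {f g h : Sym2 V} (hf : f ∈ edgeSpan A)
    (hfg : f ∉ edgeSpan (A \ {g})) (hh : h ∉ edgeSpan A) :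
    f ∉ edgeSpan (insert h A \ {g}) := by
  intro hc
  have hsub : insert h A \ {g} ⊆ insert h (A \ {g}) := by
    rintro e ⟨rfl | he, heg⟩
    · exact Set.mem_insert _ _
    · exact Set.mem_insert_of_mem _ ⟨he, heg⟩
  refine hh (edgeSpan_subset ?_ (mem_edgeSpan_insert_exchange (edgeSpan_mono hsub hc) hfg))
  rintro e (rfl | he)
  · exact hf
  · exact subset_edgeSpan _ he.1

lemma isAcyclic_fromEdgeSet_insert {A : Set (Sym2 V)} {f : Sym2 V}
    (hA : (fromEdgeSet A).IsAcyclic) (hf : f ∉ edgeSpan A) :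
    (fromEdgeSet (insert f A)).IsAcyclic := by
  induction f with | _ x y
  have := hA.sup_edge_of_not_reachable (u := x) (v := y) (mt mk_mem_edgeSpan.2 hf)
  rwa [edge, ← fromEdgeSet_union, Set.union_singleton] at this

/-- The edges of the path of the forest `A` that joins the ends of `f` are those whose removal
separates the ends of `f`. -/
lemma mem_edgeSpan_separating {A : Set (Sym2 V)} (hA : (fromEdgeSet A).IsAcyclic) {f : Sym2 V}
    (hf : f ∈ edgeSpan A) : f ∈ edgeSpan {g ∈ A | f ∉ edgeSpan (A \ {g})} := by
  classical
  induction f with | _ x y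
  obtain ⟨p, hp⟩ := (mk_mem_edgeSpan.1 hf).exists_isPath
  refine ⟨p.transfer _ fun e he => ?_⟩
  have heA := p.edges_subset_edgeSet he
  rw [edgeSet_fromEdgeSet] at heA ⊢
  refine ⟨⟨heA.1, fun hc => ?_⟩, heA.2⟩
  obtain ⟨q, hq⟩ := (mk_mem_edgeSpan.1 hc).exists_isPath
  have hle : fromEdgeSet (A \ {e}) ≤ fromEdgeSet A := fromEdgeSet_mono Set.sdiff_subset
  have hpq : p = q.mapLe hle :=
    congrArg Subtype.val ((hA.subsingleton_path x y).elim ⟨p, hp⟩ ⟨_, hq.mapLe hle⟩)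
  rw [hpq, Walk.edges_mapLe_eq_edges] at he
  have := q.edges_subset_edgeSet he
  rw [edgeSet_fromEdgeSet] at this
  exact this.1.2 rfl

section Partition

variable {ι : Type*}

/-- The edges of colour `i` in a partial edge colouring. -/
def colorClass (c : Sym2 V → Option ι) (i : ι) : Set (Sym2 V) := {e | c e = some i}

/-- The arcs `f → g` of the exchange digraph of a partial edge colouring: `g` lies on the path, in
the colour class of `g`, that joins the ends of `f`. -/
def ExchangeStep (c : Sym2 V → Option ι) (f g : Sym2 V) : Prop :=
  ∃ i, c g = some i ∧ f ∈ edgeSpan (colorClass c i) ∧ f ∉ edgeSpan (colorClass c i \ {g})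

/-- `ExchangeReach c e n f` says that the exchange digraph of `c` has a walk of length `n` from `e`
to `f`. -/
inductive ExchangeReach (c : Sym2 V → Option ι) (e : Sym2 V) : ℕ → Sym2 V → Prop
  | zero : ExchangeReach c e 0 e
  | succ {n : ℕ} {f g : Sym2 V} :
      ExchangeReach c e n f → ExchangeStep c f g → ExchangeReach c e (n + 1) g

/-- `f` can be added to some colour class without closing a cycle. -/
def IsFree (c : Sym2 V → Option ι) (f : Sym2 V) : Prop := ∃ i, f ∉ edgeSpan (colorClass c i)

lemma colorClass_update_self [DecidableEq (Sym2 V)] (c : Sym2 V → Option ι) (f : Sym2 V) (i : ι) :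
    colorClass (Function.update c f (some i)) i = insert f (colorClass c i) := by
  ext e
  by_cases h : e = f <;> simp [colorClass, h]

lemma colorClass_update_of_ne [DecidableEq (Sym2 V)] (c : Sym2 V → Option ι) (f : Sym2 V)
    {i j : ι} (hij : i ≠ j) :
    colorClass (Function.update c f (some j)) i = colorClass c i \ {f} := by
  ext e
  by_cases h : e = f <;> simp [colorClass, h, hij.symm]

lemma isAcyclic_colorClass_update [DecidableEq (Sym2 V)] {c : Sym2 V → Option ι}
    (hc : ∀ i, (fromEdgeSet (colorClass c i)).IsAcyclic) {f : Sym2 V} {j : ι}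
    (hf : f ∉ edgeSpan (colorClass c j)) (i : ι) :
    (fromEdgeSet (colorClass (Function.update c f (some j)) i)).IsAcyclic := by
  by_cases hij : i = j
  · subst hij
    rw [colorClass_update_self]
    exact isAcyclic_fromEdgeSet_insert (hc i) hf
  · rw [colorClass_update_of_ne c f hij]
    exact (hc i).anti (fromEdgeSet_mono Set.sdiff_subset)

/-- Augmentation along a shortest exchange walk. The last edge `h` of the walk moves to a class in
which it closes no cycle; as the walk has no shortcut, its other steps survive this move, and the
edge before `h` can now take the former place of `h`. -/
theorem exists_augmentation (n : ℕ) (c : Sym2 V → Option ι) (e f : Sym2 V)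
    (hc : ∀ i, (fromEdgeSet (colorClass c i)).IsAcyclic) (he : c e = none)
    (hn : ExchangeReach c e n f) (hf : IsFree c f) :
    ∃ c' : Sym2 V → Option ι, (∀ i, (fromEdgeSet (colorClass c' i)).IsAcyclic) ∧
      ∀ g, c' g = none ↔ g ≠ e ∧ c g = none := by
  classical
  induction n using Nat.strong_induction_on generalizing c f with | _ n ih
  by_cases hmin : ∃ m < n, ∃ g, ExchangeReach c e m g ∧ IsFree c g
  · obtain ⟨m, hm, g, hg, hg'⟩ := hmin
    exact ih m hm c g hc he hg hg'
  push Not at hmin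
  obtain ⟨j, hj⟩ := hf
  cases hn with
  | zero =>
    refine ⟨Function.update c e (some j), isAcyclic_colorClass_update hc hj, fun g => ?_⟩
    by_cases hg : g = e <;> simp [hg]
  | @succ n f' _ hreach hstep =>
    obtain ⟨i, hfi, hf'i, hf'f⟩ := hstep
    have hij : i ≠ j := by
      rintro rfl
      exact hj (subset_edgeSpan _ hfi)
    have hfe : e ≠ f := by
      rintro rfl
      simp [he] at hfi
    have hpersist : ∀ m g, m < n + 1 → ExchangeReach c e m g →
        ExchangeReach (Function.update c f (some j)) e m g := by
      intro m g hm hg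
      induction hg with
      | zero => exact ExchangeReach.zero
      | @succ m a b ha hab ihm =>
        refine ExchangeReach.succ (ihm (by lia)) ?_
        obtain ⟨l, hbl, hal, hal'⟩ := id hab
        have hbf : b ≠ f := by
          rintro rfl
          exact hmin (m + 1) hm b (ha.succ hab) ⟨j, hj⟩
        refine ⟨l, by rwa [Function.update_of_ne hbf], ?_⟩
        by_cases hlj : l = j
        · subst hlj
          rw [colorClass_update_self]
          exact ⟨edgeSpan_mono (Set.subset_insert _ _) hal,
            notMem_edgeSpan_insert_diff hal hal' hj⟩
        · rw [colorClass_update_of_ne c f hlj]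
          refine ⟨?_, fun h => hal' (edgeSpan_mono (Set.sdiff_subset_sdiff_left
            Set.sdiff_subset) h)⟩
          by_contra hcon
          -- Otherwise the class of `a` loses `f`, and `a → f` is a shortcut.
          by_cases hli : l = i
          · subst hli
            exact hmin (m + 1) hm f (ha.succ ⟨l, hfi, hal, hcon⟩) ⟨j, hj⟩
          · rw [Set.sdiff_singleton_eq_self] at hcon
            · exact hcon hal
            · intro h
              exact hli (Option.some_injective _ (h.symm.trans hfi))
    obtain ⟨c', hc', hsupp⟩ := ih n (by lia) (Function.update c f (some j)) f'
      (isAcyclic_colorClass_update hc hj) (by rwa [Function.update_of_ne hfe])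
      (hpersist n f' (by lia) hreach) ⟨i, by rwa [colorClass_update_of_ne c f hij]⟩
    refine ⟨c', hc', fun g => ?_⟩
    rw [hsupp]
    by_cases hg : g = f
    · subst hg
      simp [hfi]
    · rw [Function.update_of_ne hg]

/-- The edges of `G` with both ends in `U`. -/
def edgesWithin (G : SimpleGraph V) (U : Finset V) : Set (Sym2 V) :=
  {e ∈ G.edgeSet | ∀ v ∈ e, v ∈ U}

/-- If no edge reachable from the uncoloured edge `e` were free, every colour class would span the
component of `e` in the graph of reachable edges, and this component would have too many edges. -/
theorem exists_reach_isFree [Fintype V] [Fintype ι] {G : SimpleGraph V}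
    (hG : ∀ U : Finset V, U.Nonempty →
      (edgesWithin G U).ncard ≤ Fintype.card ι * (U.card - 1))
    {c : Sym2 V → Option ι} (hc : ∀ i, (fromEdgeSet (colorClass c i)).IsAcyclic)
    (hcG : ∀ f, c f ≠ none → f ∈ G.edgeSet) {e : Sym2 V} (heG : e ∈ G.edgeSet)
    (he : c e = none) : ∃ n f, ExchangeReach c e n f ∧ IsFree c f := by
  classical
  by_contra hcon
  simp only [not_exists, not_and, IsFree, not_not] at hcon
  set T : Set (Sym2 V) := {f | ∃ n, ExchangeReach c e n f} with hT
  have heT : e ∈ T := ⟨0, ExchangeReach.zero⟩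
  have hspan : ∀ i, T ⊆ edgeSpan (colorClass c i ∩ T) := by
    rintro i f ⟨n, hf⟩
    refine edgeSpan_mono ?_ (mem_edgeSpan_separating (hc i) (hcon n f hf i))
    rintro g ⟨hg, hg'⟩
    exact ⟨hg, n + 1, hf.succ ⟨i, hg, hcon n f hf i, hg'⟩⟩
  have hTG : T ⊆ G.edgeSet := by
    rintro f ⟨n, hf⟩
    cases hf with
    | zero => exact heG
    | succ _ h =>
      obtain ⟨i, hi, _⟩ := h
      exact hcG f (by simp [hi])
  induction e with | _ x y
  set U : Finset V := Finset.univ.filter fun v => (fromEdgeSet T).Reachable x v with hU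
  have hxU : x ∈ U := by simp [hU]
  have hyU : y ∈ U := by
    simp only [hU, Finset.mem_filter_univ]
    exact mk_mem_edgeSpan.1 (subset_edgeSpan T heT)
  -- The edges of colour `i` among the reachable edges form a connected graph on `U`.
  have hcount : ∀ i, U.card ≤ {f ∈ edgesWithin G U | c f = some i}.ncard + 1 := by
    intro i
    set C := (fromEdgeSet (colorClass c i ∩ T)).connectedComponentMk x
    have hCU : ∀ v, v ∈ C.supp ↔ v ∈ U := by
      intro v
      simp only [hU, Finset.mem_filter_univ, ConnectedComponent.mem_supp_iff, C,
        ConnectedComponent.eq]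
      constructor
      · intro h
        exact (h.mono (fromEdgeSet_mono Set.inter_subset_right)).symm
      · intro h
        exact (reachable_of_subset_edgeSpan (hspan i) h).symm
    have h1 := C.connected_toSimpleGraph.card_vert_le_card_edgeSet_add_one
    have h2 : Nat.card C = U.card := by
      rw [← Set.ncard_coe_finset]
      exact congrArg Set.ncard (Set.ext hCU)
    rw [h2] at h1
    refine h1.trans (Nat.add_le_add_right ?_ 1)
    rw [← Nat.card_coe_set_eq]
    refine Nat.card_le_card_of_injective
      (fun f : C.toSimpleGraph.edgeSet => ⟨f.1.map Subtype.val, ?_⟩) ?_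
    · obtain ⟨f, hf⟩ := f
      induction f with | _ a b
      have hab := (fromEdgeSet_adj _).1 (show (fromEdgeSet _).Adj a.1 b.1 from hf)
      refine ⟨⟨hTG hab.1.2, ?_⟩, hab.1.1⟩
      simp only [Sym2.map_mk, Sym2.mem_iff]
      rintro v (rfl | rfl)
      · exact (hCU _).1 a.2
      · exact (hCU _).1 b.2
    · intro f g hfg
      exact Subtype.ext (Sym2.map.injective Subtype.val_injective (congrArg Subtype.val hfg))
  have hsum : ∑ i, {f ∈ edgesWithin G U | c f = some i}.ncard + 1 ≤ (edgesWithin G U).ncard := by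
    simp only [Set.ncard_eq_toFinset_card']
    have hmem : s(x, y) ∈ (edgesWithin G U).toFinset := by
      rw [Set.mem_toFinset]
      refine ⟨heG, ?_⟩
      simp only [Sym2.mem_iff]
      rintro v (rfl | rfl) <;> assumption
    rw [← Finset.card_biUnion, Nat.add_one_le_iff]
    · refine Finset.card_lt_card (Finset.ssubset_iff_of_subset ?_ |>.2 ⟨_, hmem, ?_⟩)
      · intro f
        simp +contextual
      · simp [he]
    · intro i _ j _ hij
      refine Finset.disjoint_left.2 fun f => ?_
      simp +contextual [hij]
  have h3 := hG U ⟨x, hxU⟩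
  have h4 : Fintype.card ι * (U.card - 1) ≤
      ∑ i, {f ∈ edgesWithin G U | c f = some i}.ncard := by
    rw [← smul_eq_mul, ← Finset.card_univ, ← Finset.sum_const]
    exact Finset.sum_le_sum fun i _ => Nat.sub_le_iff_le_add.2 (hcount i)
  lia

/-- Nash-Williams' theorem, the sufficient condition: if every nonempty set `U` of vertices induces
at most `k (|U| - 1)` edges, then the graph is covered by `k` forests. -/
theorem exists_forest_cover [Fintype V] [Fintype ι] (G : SimpleGraph V)
    (hG : ∀ U : Finset V, U.Nonempty →
      (edgesWithin G U).ncard ≤ Fintype.card ι * (U.card - 1)) :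
    ∃ F : ι → SimpleGraph V, (∀ i, F i ≤ G ∧ (F i).IsAcyclic) ∧
      ∀ u v, G.Adj u v → ∃ i, (F i).Adj u v := by
  classical
  have key : ∀ S : Finset (Sym2 V), (S : Set (Sym2 V)) ⊆ G.edgeSet →
      ∃ c : Sym2 V → Option ι, (∀ i, (fromEdgeSet (colorClass c i)).IsAcyclic) ∧
        ∀ f, c f ≠ none ↔ f ∈ S := by
    intro S
    induction S using Finset.induction_on with
    | empty =>
      intro _
      refine ⟨fun _ => none, fun i => ?_, by simp⟩
      simp [colorClass]
    | insert e S heS ih =>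
      intro hS
      rw [Finset.coe_insert, Set.insert_subset_iff] at hS
      obtain ⟨c, hc, hcS⟩ := ih hS.2
      have he : c e = none := by
        by_contra h
        exact heS ((hcS e).1 h)
      obtain ⟨n, f, hf, hf'⟩ :=
        exists_reach_isFree hG hc (fun f hf => hS.2 ((hcS f).1 hf)) hS.1 he
      obtain ⟨c', hc', hc'e⟩ := exists_augmentation n c e f hc he hf hf'
      refine ⟨c', hc', fun g => ?_⟩
      rw [Ne, hc'e, Finset.mem_insert, ← hcS]
      tauto
  obtain ⟨c, hc, hcG⟩ := key G.edgeSet.toFinset (by simp)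
  refine ⟨fun i => fromEdgeSet (colorClass c i), fun i => ⟨?_, hc i⟩, fun u v huv => ?_⟩
  · intro u v huv
    have := (hcG s(u, v)).1 (by simp [show c s(u, v) = some i from ((fromEdgeSet_adj _).1 huv).1])
    simpa using this
  · obtain ⟨i, hi⟩ := Option.ne_none_iff_exists'.1 ((hcG s(u, v)).2 (by simpa using huv))
    exact ⟨i, (fromEdgeSet_adj _).2 ⟨hi, huv.ne⟩⟩

end Partition

/-! ### Functional orientations -/

/-- Every vertex has at most one out-neighbour. -/
def IsFunctional (D : Digraph V) : Prop := ∀ ⦃u v w⦄, D.Adj u v → D.Adj u w → v = w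

lemma IsOrientation.adj {D : Digraph V} {G : SimpleGraph V} (h : IsOrientation D G) {u v : V}
    (huv : D.Adj u v) : G.Adj u v := (h.1 u v).2 (Or.inl huv)

/-- A forest can be oriented towards one root in each component, and the roots can be prescribed
as long as no component gets two of them. -/
lemma exists_orientation_of_isAcyclic {F : SimpleGraph V} (hF : F.IsAcyclic) {R : Set V}
    (hR : ∀ a ∈ R, ∀ b ∈ R, F.Reachable a b → a = b) :
    ∃ D : Digraph V, IsOrientation D F ∧ IsFunctional D ∧ ∀ a ∈ R, ∀ v, ¬ D.Adj a v := by
  have hroot : ∀ C : F.ConnectedComponent, ∃ r, F.connectedComponentMk r = C ∧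
      ∀ a ∈ R, F.connectedComponentMk a = C → r = a := by
    intro C
    by_cases h : ∃ a ∈ R, F.connectedComponentMk a = C
    · obtain ⟨a, ha, haC⟩ := h
      exact ⟨a, haC, fun b hb hbC => hR a ha b hb (ConnectedComponent.exact (haC.trans hbC.symm))⟩
    · obtain ⟨r, hr⟩ := C.exists_rep
      exact ⟨r, hr, fun a ha haC => (h ⟨a, ha, haC⟩).elim⟩
  choose r hr hrR using hroot
  set ρ : V → V := fun u => r (F.connectedComponentMk u) with hρ
  have hρu : ∀ u, F.Reachable (ρ u) u := fun u => ConnectedComponent.exact (hr _)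
  have hρadj : ∀ {u v}, F.Adj u v → ρ u = ρ v := fun h =>
    congrArg r (ConnectedComponent.sound h.reachable)
  refine ⟨⟨fun u v => F.Adj u v ∧ F.dist (ρ u) u = F.dist (ρ u) v + 1⟩, ⟨fun u v => ?_, ?_⟩, ?_, ?_⟩
  · constructor
    · intro h
      rcases hF.dist_eq_dist_add_one_of_adj_of_reachable (ρ u) h (hρu u) with h' | h'
      · exact Or.inl ⟨h, h'⟩
      · exact Or.inr ⟨h.symm, by rwa [← hρadj h]⟩
    · rintro (h | h)
      · exact h.1
      · exact h.1.symm
  · rintro u v ⟨h, h1⟩ ⟨_, h2⟩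
    rw [← hρadj h] at h2
    lia
  · rintro u v w ⟨hv, hv'⟩ ⟨hw, hw'⟩
    obtain ⟨p, hp⟩ := ((hρu u).trans hv.reachable).exists_walk_length_eq_dist
    obtain ⟨q, hq⟩ := ((hρu u).trans hw.reachable).exists_walk_length_eq_dist
    have hp' : (p.concat hv.symm).IsPath :=
      Walk.isPath_of_length_eq_dist _ (by rw [Walk.length_concat, hp, hv'])
    have hq' : (q.concat hw.symm).IsPath :=
      Walk.isPath_of_length_eq_dist _ (by rw [Walk.length_concat, hq, hw'])
    have := congrArg (fun x => Walk.penultimate x.1)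
      ((hF.subsingleton_path _ _).elim ⟨_, hp'⟩ ⟨_, hq'⟩)
    simpa using this
  · rintro a ha v ⟨_, h⟩
    have : ρ a = a := hrR _ a ha rfl
    rw [this, dist_self] at h
    lia

/-- After the removal of one edge from the cycle of each component that has one, a pseudoforest is
a forest; orient it so that an end of the removed edge is the root, which leaves this end free to
become the tail of the removed edge. -/
theorem Pseudoforest.exists_orientation {H : SimpleGraph V} (hH : Pseudoforest H) :
    ∃ D : Digraph V, IsOrientation D H ∧ IsFunctional D := by
  have hcyc : ∀ C : {C : H.ConnectedComponent // ∃ (u : V) (c : H.Walk u u), c.IsCycle ∧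
      H.connectedComponentMk u = C}, ∃ a b, H.Adj a b ∧ H.connectedComponentMk a = C.1 ∧
      ∀ (v : V) (d : H.Walk v v), d.IsCycle → H.connectedComponentMk v = C → s(a, b) ∈ d.edges := by
    rintro ⟨_, u, c, hc, rfl⟩
    have hadj := c.adj_snd hc.not_nil
    refine ⟨u, c.snd, hadj, rfl, fun v d hd hv => ?_⟩
    exact (hH u v c d hc hd (ConnectedComponent.exact hv).symm _).1
      (c.mk_start_snd_mem_edges hc.not_nil)
  choose a b hab haC hcd using hcyc
  have hle := H.deleteEdges_le (Set.range fun C => s(a C, b C))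
  have hF : (H.deleteEdges (Set.range fun C => s(a C, b C))).IsAcyclic := by
    intro v d hd
    have hd' : (d.mapLe hle).IsCycle := hd.mapLe hle
    have hmem := hcd ⟨H.connectedComponentMk v, v, _, hd', rfl⟩ v _ hd' rfl
    rw [Walk.edges_mapLe_eq_edges] at hmem
    have := d.edges_subset_edgeSet hmem
    rw [edgeSet_deleteEdges] at this
    exact this.2 ⟨_, rfl⟩
  have ha : ∀ C C', H.Reachable (a C) (a C') → C = C' := by
    intro C C' h
    exact Subtype.ext ((haC C).symm.trans ((ConnectedComponent.sound h).trans (haC C')))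
  obtain ⟨D, ⟨hD1, hD2⟩, hDf, hDR⟩ := exists_orientation_of_isAcyclic hF (R := Set.range a) (by
    rintro _ ⟨C, rfl⟩ _ ⟨C', rfl⟩ h
    rw [ha C C' (h.mono hle)])
  have hDH : ∀ {u v}, D.Adj u v → H.Adj u v ∧ ∀ C, s(a C, b C) ≠ s(u, v) := by
    intro u v h
    have := (hD1 u v).2 (Or.inl h)
    rw [deleteEdges_adj] at this
    exact ⟨this.1, fun C hC => this.2 ⟨C, hC⟩⟩
  refine ⟨⟨fun u v => D.Adj u v ∨ ∃ C, u = a C ∧ v = b C⟩, ⟨fun u v => ?_, ?_⟩, ?_⟩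
  · constructor
    · intro h
      by_cases hC : ∃ C, s(a C, b C) = s(u, v)
      · obtain ⟨C, hC⟩ := hC
        rcases Sym2.eq_iff.1 hC with ⟨h1, h2⟩ | ⟨h1, h2⟩
        · exact Or.inl (Or.inr ⟨C, h1.symm, h2.symm⟩)
        · exact Or.inr (Or.inr ⟨C, h1.symm, h2.symm⟩)
      · have := (hD1 u v).1 (by rw [deleteEdges_adj]; exact ⟨h, hC⟩)
        exact this.imp Or.inl Or.inl
    · rintro ((h | ⟨C, rfl, rfl⟩) | (h | ⟨C, rfl, rfl⟩))
      · exact (hDH h).1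
      · exact hab C
      · exact (hDH h).1.symm
      · exact (hab C).symm
  · rintro u v (h | ⟨C, rfl, rfl⟩) (h' | ⟨C', h1, h2⟩)
    · exact hD2 _ _ h h'
    · exact (hDH h).2 C' (by rw [← h1, ← h2, Sym2.eq_swap])
    · exact (hDH h').2 C (Sym2.eq_swap)
    · have : C = C' := ha C C' (h1 ▸ (hab C).reachable)
      subst this
      exact (hab C).ne h2
  · rintro u v w (h | ⟨C, rfl, rfl⟩) (h' | ⟨C', h1, rfl⟩)
    · exact hDf h h'
    · exact (hDR _ ⟨C', rfl⟩ _ (h1 ▸ h)).elim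
    · exact (hDR _ ⟨C, rfl⟩ _ h').elim
    · rw [ha C C' (by rw [h1])]

/-- If a trail starts against an arc of a functional orientation, it runs against the arcs
throughout. -/
lemma IsFunctional.adj_penultimate {D : Digraph V} {H : SimpleGraph V} (hD : IsOrientation D H)
    (hf : IsFunctional D) {u v : V} (p : H.Walk u v) (hp : p.IsTrail) (hn : ¬ p.Nil)
    (h : D.Adj p.snd u) : D.Adj v p.penultimate := by
  induction p with
  | nil => simp at hn
  | @cons u x v hux q ih =>
    cases q with
    | nil => simpa using h
    | @cons _ y _ hxy q =>
      rw [Walk.penultimate_cons_cons]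
      refine ih hp.of_cons Walk.not_nil_cons ?_
      rw [Walk.snd_cons] at h ⊢
      refine ((hD.1 x y).1 hxy).resolve_left fun hxy' => ?_
      obtain rfl := hf h hxy'
      have := hp.edges_nodup
      simp [Sym2.eq_swap] at this

/-- A cycle of a functional orientation contains the arc that leaves any of its vertices. -/
lemma IsFunctional.exists_adj_of_mem_cycle {D : Digraph V} {H : SimpleGraph V}
    (hD : IsOrientation D H) (hf : IsFunctional D) {v w : V} {d : H.Walk v v} (hd : d.IsCycle)
    (hw : w ∈ d.support) : ∃ x, D.Adj w x ∧ x ∈ d.support := by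
  classical
  have hr := hd.rotate hw
  have hsup : ∀ x, x ∈ (d.rotate w hw).support → x ∈ d.support := fun x hx => by
    simpa using hx
  rcases (hD.1 _ _).1 ((d.rotate w hw).adj_snd hr.not_nil) with h | h
  · exact ⟨_, h, hsup _ (Walk.getVert_mem_support _ _)⟩
  · exact ⟨_, hf.adj_penultimate hD _ hr.isTrail hr.not_nil h,
      hsup _ (Walk.getVert_mem_support _ _)⟩

/-- The component of a vertex without out-neighbours has no cycles: all its vertices lead to this
vertex, but no arc leaves a cycle. -/
lemma IsFunctional.not_isCycle_of_reachable {D : Digraph V} {H : SimpleGraph V}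
    (hD : IsOrientation D H) (hf : IsFunctional D) {a v : V} (ha : ∀ x, ¬ D.Adj a x)
    (hav : H.Reachable v a) (d : H.Walk v v) : ¬ d.IsCycle := by
  intro hd
  have hlead : Relation.ReflTransGen D.Adj v a := by
    obtain ⟨p⟩ := hav
    clear hd d
    induction p with
    | nil => exact Relation.ReflTransGen.refl
    | @cons x y _ hxy _ ih =>
      have hy := ih ha
      rcases (hD.1 _ _).1 hxy with h | h
      · exact Relation.ReflTransGen.head h hy
      · rcases Relation.ReflTransGen.cases_head hy with rfl | ⟨z, hz, hz'⟩
        · exact (ha _ h).elim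
        · rwa [hf h hz]
  have hmem : ∀ w, Relation.ReflTransGen D.Adj v w → w ∈ d.support := by
    intro w hw
    induction hw with
    | refl => exact d.start_mem_support
    | tail _ hab ih =>
      obtain ⟨x, hx, hx'⟩ := hf.exists_adj_of_mem_cycle hD hd ih
      rwa [hf hab hx]
  obtain ⟨x, hx, _⟩ := hf.exists_adj_of_mem_cycle hD hd (hmem a hlead)
  exact ha x hx

/-- If an edge of a cycle `c` is missing from a cycle `d` in the same component, remove it: the
component stays connected and retains `d`, but the tail of the removed edge has lost its only
out-neighbour. -/
theorem IsFunctional.pseudoforest {D : Digraph V} {H : SimpleGraph V}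
    (hD : IsOrientation D H) (hf : IsFunctional D) : Pseudoforest H := by
  suffices key : ∀ (u v : V) (c : H.Walk u u) (d : H.Walk v v), c.IsCycle → d.IsCycle →
      H.Reachable u v → ∀ e, e ∈ c.edges → e ∈ d.edges from
    fun u v c d hc hd huv e => ⟨key u v c d hc hd huv e, key v u d c hd hc huv.symm e⟩
  classical
  intro u v c d hc hd huv e hec
  by_contra hed
  obtain ⟨a, b, rfl, hab⟩ : ∃ a b, e = s(a, b) ∧ D.Adj a b := by
    induction e with | _ x y
    rcases (hD.1 _ _).1 (c.adj_of_mem_edges hec) with h | h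
    · exact ⟨x, y, rfl, h⟩
    · exact ⟨y, x, Sym2.eq_swap, h⟩
  have hreach : ∀ {x y}, H.Reachable x y → (H.deleteEdges {s(a, b)}).Reachable x y := by
    have hab' := (adj_and_reachable_delete_edges_iff_exists_cycle.2 ⟨u, c, hc, hec⟩).2
    rintro x y ⟨p⟩
    induction p with
    | nil => exact Reachable.refl _
    | @cons x y z hxy _ ih =>
      refine Reachable.trans ?_ ih
      by_cases h : s(x, y) = s(a, b)
      · rcases Sym2.eq_iff.1 h with ⟨rfl, rfl⟩ | ⟨rfl, rfl⟩
        · exact hab'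
        · exact hab'.symm
      · exact Adj.reachable (by rw [deleteEdges_adj]; exact ⟨hxy, h⟩)
  let D' : Digraph V := ⟨fun x y => D.Adj x y ∧ s(x, y) ≠ s(a, b)⟩
  have hD' : IsOrientation D' (H.deleteEdges {s(a, b)}) := by
    refine ⟨fun x y => ?_, fun x y h h' => hD.2 x y h.1 h'.1⟩
    rw [deleteEdges_adj, hD.1, Set.mem_singleton_iff]
    simp only [D', Sym2.eq_swap (a := y) (b := x)]
    tauto
  have hf' : IsFunctional D' := fun x y z h h' => hf h.1 h'.1
  have hedge : ∀ f ∈ d.edges, f ∈ (H.deleteEdges {s(a, b)}).edgeSet := by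
    intro f hfd
    rw [edgeSet_deleteEdges]
    refine ⟨d.edges_subset_edgeSet hfd, ?_⟩
    rintro rfl
    exact hed hfd
  refine hf'.not_isCycle_of_reachable hD' (a := a) ?_ (hreach ?_) _ (hd.transfer hedge)
  · rintro x ⟨h, hne⟩
    exact hne (by rw [hf h hab])
  · refine huv.symm.trans ⟨c.takeUntil a (c.fst_mem_support_of_mem_edges hec)⟩

/-! ### Covers by pseudoforests -/

lemma Forest.pseudoforest {T : SimpleGraph V} (hT : Forest T) : Pseudoforest T :=
  fun _ _ c _ hc => (hT c hc).elim

/-- Colouring the arcs that leave each vertex with different colours decomposes a digraph with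
out-degrees at most `k` into `k` functional digraphs. -/
lemma exists_functional_decomposition [Finite V] {D : Digraph V} {k : ℕ}
    (hk : ∀ v, outDegree D v ≤ k) :
    ∃ E : Fin k → Digraph V, (∀ i, IsFunctional (E i)) ∧
      ∀ u v, D.Adj u v ↔ ∃ i, (E i).Adj u v := by
  have hcol : ∀ u, Nonempty ({v | D.Adj u v} ↪ Fin k) := by
    intro u
    have := Fintype.ofFinite {v | D.Adj u v}
    refine Function.Embedding.nonempty_of_card_le ?_
    rw [Fintype.card_fin, ← Nat.card_eq_fintype_card]
    exact hk u
  let col u := (hcol u).some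
  refine ⟨fun i => ⟨fun u v => ∃ h : D.Adj u v, col u ⟨v, h⟩ = i⟩, ?_, fun u v => ?_⟩
  · rintro i u v w ⟨hv, h⟩ ⟨hw, h'⟩
    exact congrArg Subtype.val ((col u).injective (h.trans h'.symm))
  · exact ⟨fun h => ⟨_, h, rfl⟩, fun ⟨_, h, _⟩ => h⟩

lemma exists_pseudoforest_cover_of_orientation [Finite V] {G : SimpleGraph V} {D : Digraph V}
    (hD : IsOrientation D G) {k : ℕ} (hk : ∀ v, outDegree D v ≤ k) :
    ∃ H : Fin k → G.Subgraph, IsInjectiveCover Pseudoforest G H := by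
  obtain ⟨E, hE, hDE⟩ := exists_functional_decomposition hk
  have hED : ∀ {i u v}, (E i).Adj u v → D.Adj u v := fun h => (hDE _ _).2 ⟨_, h⟩
  let S : Fin k → G.Subgraph := fun i =>
    { verts := Set.univ
      Adj := fun u v => (E i).Adj u v ∨ (E i).Adj v u
      adj_sub := fun {u v} h => (hD.1 u v).2 (h.imp hED hED)
      edge_vert := fun _ => Set.mem_univ _
      symm := ⟨fun u v h => h.symm⟩ }
  refine ⟨S, fun i => ?_, fun u v huv => ?_⟩
  · let D' : Digraph (S i).verts := ⟨fun u v => (E i).Adj u v⟩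
    have hD' : IsOrientation D' (S i).coe :=
      ⟨fun u v => Iff.rfl, fun u v h h' => hD.2 _ _ (hED h) (hED h')⟩
    have hf' : IsFunctional D' := fun u v w h h' => Subtype.ext (hE i h h')
    exact hf'.pseudoforest hD'
  · rcases (hD.1 u v).1 huv with h | h
    · obtain ⟨i, hi⟩ := (hDE _ _).1 h
      exact ⟨i, Or.inl hi⟩
    · obtain ⟨i, hi⟩ := (hDE _ _).1 h
      exact ⟨i, Or.inr hi⟩

/-- The image in `V` of an orientation of a subgraph. -/
def extendDigraph {G : SimpleGraph V} {H : G.Subgraph} (D : Digraph H.verts) : Digraph V :=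
  ⟨fun u v => ∃ (hu : u ∈ H.verts) (hv : v ∈ H.verts), D.Adj ⟨u, hu⟩ ⟨v, hv⟩⟩

lemma IsOrientation.extendDigraph {G : SimpleGraph V} {H : G.Subgraph} {D : Digraph H.verts}
    (hD : IsOrientation D H.coe) : IsOrientation (extendDigraph D) H.spanningCoe := by
  constructor
  · intro u v
    constructor
    · intro h
      exact ((hD.1 ⟨u, H.edge_vert h⟩ ⟨v, H.edge_vert h.symm⟩).1 h).imp
        (fun h => ⟨_, _, h⟩) (fun h => ⟨_, _, h⟩)
    · rintro (⟨hu, hv, h⟩ | ⟨hv, hu, h⟩)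
      · exact hD.adj h
      · exact (hD.adj h).symm
  · rintro u v ⟨_, _, h⟩ ⟨_, _, h'⟩
    exact hD.2 _ _ h h'

lemma IsFunctional.extendDigraph {G : SimpleGraph V} {H : G.Subgraph} {D : Digraph H.verts}
    (hD : IsFunctional D) : IsFunctional (extendDigraph D) := by
  rintro u v w ⟨_, _, h⟩ ⟨_, _, h'⟩
  exact congrArg Subtype.val (hD h h')

/-- Functional orientations of the members of a cover combine to an orientation of the covered
graph: each edge is directed as in one member that contains it. Every vertex then has at most one
out-neighbour for each member in which it has one. -/
lemma exists_orientation_of_cover [Finite V] {G : SimpleGraph V} {k : ℕ} {H : Fin k → G.Subgraph}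
    (hH : ∀ u v, G.Adj u v → ∃ i, (H i).Adj u v) {E : Fin k → Digraph V}
    (hE : ∀ i, IsOrientation (E i) (H i).spanningCoe) (hf : ∀ i, IsFunctional (E i)) :
    ∃ D : Digraph V, IsOrientation D G ∧ (∀ u v, D.Adj u v → ∃ i, (E i).Adj u v) ∧
      ∀ v, outDegree D v ≤ {i | ∃ w, (E i).Adj v w}.ncard := by
  classical
  have hidx : ∀ e : G.edgeSet, ∃ i, e.1 ∈ (H i).edgeSet := by
    rintro ⟨⟨u, v⟩, he⟩
    exact hH u v he
  choose idx hidx using hidx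
  let D : Digraph V := ⟨fun u v => ∃ h : G.Adj u v, (E (idx ⟨s(u, v), h⟩)).Adj u v⟩
  have hswap : ∀ {u v} (h : G.Adj u v), idx ⟨s(v, u), h.symm⟩ = idx ⟨s(u, v), h⟩ := fun h =>
    congrArg idx (Subtype.ext Sym2.eq_swap)
  refine ⟨D, ⟨fun u v => ⟨fun h => ?_, ?_⟩, ?_⟩, fun u v ⟨_, h⟩ => ⟨_, h⟩, fun v => ?_⟩
  · refine (((hE _).1 u v).1 (hidx ⟨s(u, v), h⟩)).imp (fun h' => ⟨h, h'⟩) (fun h' => ⟨h.symm, ?_⟩)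
    rwa [hswap h]
  · rintro (⟨h, _⟩ | ⟨h, _⟩)
    · exact h
    · exact h.symm
  · rintro u v ⟨h, h1⟩ ⟨_, h2⟩
    rw [hswap h] at h2
    exact (hE _).2 _ _ h1 h2
  · refine Nat.card_le_card_of_injective
      (fun w : {w | D.Adj v w} => (⟨idx ⟨s(v, w), w.2.choose⟩, w, w.2.choose_spec⟩ :
        {i | ∃ w, (E i).Adj v w})) ?_
    rintro ⟨w, hw⟩ ⟨w', hw'⟩ h
    have h' : idx ⟨s(v, w), hw.choose⟩ = idx ⟨s(v, w'), hw'.choose⟩ := congrArg Subtype.val h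
    have h2 := hw'.choose_spec
    rw [← h'] at h2
    exact Subtype.ext (hf _ hw.choose_spec h2)

lemma exists_orientation_of_pseudoforest_cover [Finite V] {G : SimpleGraph V} {k : ℕ}
    {H : Fin k → G.Subgraph} (hH : IsInjectiveCover Pseudoforest G H) :
    ∃ D : Digraph V, IsOrientation D G ∧ ∀ v, outDegree D v ≤ k := by
  choose E hE hf using fun i => Pseudoforest.exists_orientation (hH.1 i)
  obtain ⟨D, hD, _, hk⟩ := exists_orientation_of_cover hH.2
    (fun i => (hE i).extendDigraph) (fun i => (hf i).extendDigraph)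
  refine ⟨D, hD, fun v => (hk v).trans ?_⟩
  simpa using Set.ncard_le_card (s := {i | ∃ w, (extendDigraph (E i)).Adj v w})

/-! ### Covers by star forests -/

/-- A subgraph all of whose edges contain the vertex `c` is a star forest. -/
lemma starForest_of_center {G : SimpleGraph V} {H : G.Subgraph} {c : V}
    (hc : ∀ u v, H.Adj u v → u = c ∨ v = c) : StarForest H.coe := by
  constructor
  · refine (isAcyclic_starGraph c).comap ⟨Subtype.val, ?_⟩ Subtype.val_injective
    intro u v h
    exact starGraph_adj.2 ⟨H.coe_adj_sub _ _ h |>.ne, hc _ _ h⟩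
  · intro u v q hq h3
    have hinj : ∀ i j, i ≤ 3 → j ≤ 3 → (q.getVert i : V) = q.getVert j → i = j := by
      intro i j hi hj h
      exact hq.getVert_injOn (by simpa [h3] using hi) (by simpa [h3] using hj) (Subtype.ext h)
    -- The first and the third edge of the path are disjoint.
    have h01 := hc _ _ (q.adj_getVert_succ (i := 0) (by lia))
    have h23 := hc _ _ (q.adj_getVert_succ (i := 2) (by lia))
    rcases h01 with h | h <;> rcases h23 with h' | h' <;>
      exact absurd (hinj _ _ (by lia) (by lia) (h.trans h'.symm)) (by lia)

/-- Orient the edges of a star forest from the leaves to the centres of the stars; in a star with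
one edge an arbitrary well-order on the vertices chooses the centre. -/
lemma StarForest.exists_orientation {T : SimpleGraph V} (hT : StarForest T) :
    ∃ D : Digraph V, IsOrientation D T ∧ IsFunctional D ∧
      ∀ u v w, D.Adj u v → ¬ D.Adj v w := by
  have hleaf : ∀ u v, T.Adj u v →
      (∀ w, T.Adj u w → w = v) ∨ (∀ w, T.Adj v w → w = u) := by
    intro u v huv
    by_contra! h
    obtain ⟨⟨x, hux, hxv⟩, y, hvy, hyu⟩ := h
    by_cases hxy : x = y
    · subst hxy
      refine hT.1 (Walk.cons huv (Walk.cons hvy (Walk.cons hux.symm Walk.nil))) ?_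
      simp [Walk.cons_isCycle_iff, huv.ne, huv.ne', hux.ne, hux.ne', hvy.ne]
    · refine hT.2 x y (Walk.cons hux.symm (Walk.cons huv (Walk.cons hvy Walk.nil))) ?_ rfl
      simp [Walk.cons_isPath_iff, huv.ne, hux.ne', hxv, hvy.ne, hxy, hyu.symm]
  refine ⟨⟨fun u v => T.Adj u v ∧ (∀ w, T.Adj u w → w = v) ∧
    ((∀ w, T.Adj v w → w = u) → WellOrderingRel u v)⟩, ⟨fun u v => ⟨fun h => ?_, ?_⟩, ?_⟩, ?_, ?_⟩
  · by_cases hu : ∀ w, T.Adj u w → w = v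
    · by_cases hv : ∀ w, T.Adj v w → w = u
      · rcases trichotomous_of WellOrderingRel u v with h' | h' | h'
        · exact Or.inl ⟨h, hu, fun _ => h'⟩
        · exact (h.ne h').elim
        · exact Or.inr ⟨h.symm, hv, fun _ => h'⟩
      · exact Or.inl ⟨h, hu, fun h' => (hv h').elim⟩
    · exact Or.inr ⟨h.symm, (hleaf u v h).resolve_left hu, fun h' => (hu h').elim⟩
  · rintro (h | h)
    · exact h.1
    · exact h.1.symm
  · rintro u v ⟨_, hu, h⟩ ⟨_, hv, h'⟩
    exact asymm_of WellOrderingRel (h hv) (h' hu)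
  · rintro u v w ⟨_, h, _⟩ ⟨hw, _, _⟩
    exact (h w hw).symm
  · rintro u v w ⟨huv, hu, h⟩ ⟨hvw, hv, h'⟩
    obtain rfl := hv u huv.symm
    exact asymm_of WellOrderingRel (h hv) (h' hu)

/-- Orientations of the members of a star forest cover from the leaves to the centres, transported
to the vertex set of the covered graph. -/
lemma exists_star_orientations {G : SimpleGraph V} {n : ℕ} {H : Fin n → G.Subgraph}
    (hH : IsInjectiveCover StarForest G H) :
    ∃ E : Fin n → Digraph V, (∀ i, IsOrientation (E i) (H i).spanningCoe) ∧
      (∀ i, IsFunctional (E i)) ∧ ∀ i u v w, (E i).Adj u v → ¬ (E i).Adj v w := by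
  choose E hE hf hs using fun i => StarForest.exists_orientation (hH.1 i)
  refine ⟨fun i => extendDigraph (E i), fun i => (hE i).extendDigraph,
    fun i => (hf i).extendDigraph, ?_⟩
  rintro i u v w ⟨_, _, h⟩ ⟨_, _, h'⟩
  exact hs _ _ _ _ h h'

lemma outDegree_eq_ncard_neighborSet_iff [Finite V] {G : SimpleGraph V} {D : Digraph V}
    (hD : IsOrientation D G) (v : V) :
    outDegree D v = (G.neighborSet v).ncard ↔ ∀ u, ¬ D.Adj u v := by
  constructor
  · intro h u hu
    have := Set.eq_of_subset_of_ncard_le (fun _ h => hD.adj h : {w | D.Adj v w} ⊆ G.neighborSet v)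
      h.ge
    have hv : u ∈ {w | D.Adj v w} := this ▸ (hD.adj hu).symm
    exact hD.2 _ _ hu hv
  · intro h
    refine congrArg Set.ncard (Set.ext fun w => ?_)
    rw [mem_neighborSet, hD.1, Set.mem_ofPred_eq]
    exact ⟨Or.inl, fun h' => h'.resolve_right (h w)⟩

/-- A local star cover with at most `k` members at each vertex yields an orientation with
out-degrees at most `k`. At a vertex of out-degree `k` every member leaves an arc, so it is a leaf
in all members that contain it. -/
lemma exists_orientation_of_starForest_cover [Finite V] {G : SimpleGraph V} {n k : ℕ}
    {H : Fin n → G.Subgraph} (hH : IsInjectiveCover StarForest G H)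
    (hk : ∀ v, {i | v ∈ (H i).verts}.ncard ≤ k) :
    ∃ D : Digraph V, IsOrientation D G ∧ (∀ v, outDegree D v ≤ k) ∧
      ∀ v, outDegree D v = k → (G.neighborSet v).ncard = k := by
  obtain ⟨E, hE, hf, hs⟩ := exists_star_orientations hH
  obtain ⟨D, hD, hDE, hdeg⟩ := exists_orientation_of_cover hH.2 hE hf
  have hsub : ∀ v, {i | ∃ w, (E i).Adj v w} ⊆ {i | v ∈ (H i).verts} := fun v i ⟨w, h⟩ =>
    (H i).edge_vert ((hE i).adj h)
  have hle : ∀ v, outDegree D v ≤ k := fun v =>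
    (hdeg v).trans ((Set.ncard_le_ncard (hsub v)).trans (hk v))
  refine ⟨D, hD, hle, fun v hv => ?_⟩
  rw [← hv, eq_comm, outDegree_eq_ncard_neighborSet_iff hD]
  intro u hu
  obtain ⟨i, hi⟩ := hDE u v hu
  have heq := Set.eq_of_subset_of_ncard_le (hsub v) ((hk v).trans (hv ▸ hdeg v))
  have hiv : i ∈ {i | v ∈ (H i).verts} := (H i).edge_vert ((hE i).adj hi).symm
  rw [← heq] at hiv
  obtain ⟨w, hw⟩ := hiv
  exact hs i u v w hi hw

/-- The stars consisting of a vertex and its in-neighbours cover the graph; a vertex without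
in-neighbours gets the empty subgraph, so a source of out-degree `k` lies in only `k` stars. -/
lemma exists_starForest_cover_of_orientation [Finite V] {G : SimpleGraph V} {D : Digraph V}
    (hD : IsOrientation D G) {k : ℕ} (hk : ∀ v, outDegree D v ≤ k)
    (hk' : ∀ v, outDegree D v = k → (G.neighborSet v).ncard = k) :
    ∃ (n : ℕ) (H : Fin n → G.Subgraph), IsInjectiveCover StarForest G H ∧
      ∀ v, {i | v ∈ (H i).verts}.ncard ≤ k := by
  obtain ⟨n, ⟨φ⟩⟩ := Finite.exists_equiv_fin V
  let S : V → G.Subgraph := fun c =>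
    { verts := {x | D.Adj x c ∨ (x = c ∧ ∃ u, D.Adj u c)}
      Adj := fun u v => (D.Adj u v ∧ v = c) ∨ (D.Adj v u ∧ u = c)
      adj_sub := fun {u v} h => (hD.1 u v).2 (h.imp And.left And.left)
      edge_vert := by
        rintro u v (⟨h, rfl⟩ | ⟨h, rfl⟩)
        · exact Or.inl h
        · exact Or.inr ⟨rfl, v, h⟩
      symm := ⟨fun u v h => h.symm⟩ }
  refine ⟨n, fun i => S (φ.symm i), ⟨fun i => ?_, fun u v h => ?_⟩, fun v => ?_⟩
  · exact starForest_of_center (c := φ.symm i) fun u v h => (h.imp And.right And.right).symm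
  · rcases (hD.1 u v).1 h with h | h
    · exact ⟨φ v, Or.inl ⟨h, by simp⟩⟩
    · exact ⟨φ u, Or.inr ⟨h, by simp⟩⟩
  · have hcard : {i | v ∈ (S (φ.symm i)).verts}.ncard = {c | v ∈ (S c).verts}.ncard :=
      Set.ncard_preimage_of_injective_subset_range (s := {c | v ∈ (S c).verts}) φ.symm.injective
        (by simp)
    rw [hcard]
    by_cases hin : ∃ u, D.Adj u v
    · have hlt : outDegree D v < k := by
        refine (hk v).lt_of_ne fun h => ?_
        have := (outDegree_eq_ncard_neighborSet_iff hD v).1 (h.trans (hk' v h).symm)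
        exact hin.elim this
      refine le_trans (Set.ncard_le_ncard (t := insert v {w | D.Adj v w}) ?_)
        ((Set.ncard_insert_le _ _).trans hlt)
      rintro c (h | ⟨rfl, _⟩)
      · exact Set.mem_insert_of_mem _ h
      · exact Set.mem_insert _ _
    · refine le_trans (Set.ncard_le_ncard ?_) (hk v)
      rintro c (h | ⟨rfl, h⟩)
      · exact h
      · exact (hin h).elim

/-! ### From local star covers to forest covers -/

/-- The sparsity condition of Nash-Williams' theorem for a graph with a local star cover. Count the
pairs of a vertex of `U` and a member containing it, at most `t |U|` of them if `t` is the largest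
number of members at a vertex of `U`. Only pairs in which the vertex leaves an arc of the member
inside `U` account for an edge, and each of the `t` members at a vertex attaining the maximum
has a vertex in `U` that leaves none. -/
lemma ncard_edgesWithin_le_of_starForest_cover [Finite V] {G : SimpleGraph V} {n k : ℕ}
    {H : Fin n → G.Subgraph} (hH : IsInjectiveCover StarForest G H)
    (hk : ∀ v, {i | v ∈ (H i).verts}.ncard ≤ k) {U : Finset V} (hU : U.Nonempty) :
    (edgesWithin G U).ncard ≤ k * (U.card - 1) := by
  classical
  obtain ⟨E, hE, hf, hs⟩ := exists_star_orientations hH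
  let t : V → ℕ := fun v => (Finset.univ.filter fun i => v ∈ (H i).verts).card
  have ht : ∀ v, t v ≤ k := by
    intro v
    refine le_trans (le_of_eq ?_) (hk v)
    simp [t, ← Set.ncard_coe_finset]
  obtain ⟨z, hzU, hz⟩ := U.exists_max_image t hU
  let Q : Finset (V × Fin n) := (U ×ˢ Finset.univ).filter fun p => p.1 ∈ (H p.2).verts
  let P : Finset (V × Fin n) := Q.filter fun p => ∃ w ∈ U, (E p.2).Adj p.1 w
  have hQ : Q.card ≤ U.card * t z := by
    have : Q.card = ∑ v ∈ U, t v := by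
      simp only [Q, t, Finset.card_filter, Finset.sum_product]
    rw [this, ← smul_eq_mul]
    exact Finset.sum_le_card_nsmul _ _ _ hz
  have hmiss : ∀ i, z ∈ (H i).verts → ∃ w ∈ U, w ∈ (H i).verts ∧ ∀ x ∈ U, ¬ (E i).Adj w x := by
    intro i hi
    by_cases h : ∃ w ∈ U, (E i).Adj z w
    · obtain ⟨w, hw, hzw⟩ := h
      exact ⟨w, hw, (H i).edge_vert ((hE i).adj hzw).symm, fun x _ => hs i z w x hzw⟩
    · exact ⟨z, hzU, hi, fun x hx hzx => h ⟨x, hx, hzx⟩⟩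
  have : Nonempty V := ⟨z⟩
  choose! m hmU hmH hm using hmiss
  have hQP : t z ≤ (Q \ P).card := by
    refine Finset.card_le_card_of_injOn (fun i => (m i, i)) ?_ fun i _ j _ h =>
      congrArg Prod.snd h
    intro i hi
    have hi' : z ∈ (H i).verts := by simpa using hi
    simp only [Finset.coe_sdiff, Set.mem_sdiff, Finset.mem_coe, P, Q, Finset.mem_filter,
      Finset.mem_product, Finset.mem_univ, and_true, not_and, not_exists]
    exact ⟨⟨hmU i hi', hmH i hi'⟩, fun _ x hx => hm i hi' x hx⟩
  have hedges : (edgesWithin G U).ncard ≤ P.card := by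
    let f : V × Fin n → Sym2 V := fun p =>
      if h : ∃ w ∈ U, (E p.2).Adj p.1 w then s(p.1, h.choose) else s(p.1, p.1)
    have hfE : ∀ {u v i}, u ∈ U → v ∈ U → (E i).Adj u v → s(u, v) ∈ P.image f := by
      intro u v i hu hv h
      have hex : ∃ w ∈ U, (E i).Adj u w := ⟨v, hv, h⟩
      refine Finset.mem_image.2 ⟨(u, i), ?_, ?_⟩
      · simpa [P, Q, hu, (H i).edge_vert ((hE i).adj h)] using hex
      · simp only [f, dif_pos hex]
        rw [hf i hex.choose_spec.2 h]
    refine le_trans (Set.ncard_le_ncard (t := (P.image f : Set (Sym2 V))) ?_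
      (Finset.finite_toSet _)) ((Set.ncard_coe_finset _).trans_le Finset.card_image_le)
    rintro e ⟨heG, heU⟩
    induction e with | _ u v
    have hu := heU u (Sym2.mem_mk_left u v)
    have hv := heU v (Sym2.mem_mk_right u v)
    obtain ⟨i, hi⟩ := hH.2 u v heG
    rcases ((hE i).1 u v).1 hi with h | h
    · exact hfE hu hv h
    · rw [Sym2.eq_swap]
      exact hfE hv hu h
  have hPQ : P ⊆ Q := Finset.filter_subset _ _
  have hsd := Finset.card_sdiff_add_card_eq_card hPQ
  calc (edgesWithin G U).ncard ≤ U.card * t z - t z := by lia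
    _ = t z * (U.card - 1) := by rw [Nat.mul_sub, mul_one, mul_comm]
    _ ≤ k * (U.card - 1) := Nat.mul_le_mul_right _ (ht z)

lemma exists_forest_cover_of_starForest_cover [Finite V] {G : SimpleGraph V} {n k : ℕ}
    {H : Fin n → G.Subgraph} (hH : IsInjectiveCover StarForest G H)
    (hk : ∀ v, {i | v ∈ (H i).verts}.ncard ≤ k) :
    ∃ F : Fin k → G.Subgraph, IsInjectiveCover Forest G F := by
  have := Fintype.ofFinite V
  obtain ⟨F, hF, hFG⟩ := exists_forest_cover (ι := Fin k) G fun U hU => by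
    simpa using ncard_edgesWithin_le_of_starForest_cover hH hk hU
  refine ⟨fun i => SimpleGraph.toSubgraph (F i) (hF i).1, fun i => ?_, hFG⟩
  exact (hF i).2.comap ⟨Subtype.val, fun h => h⟩ Subtype.val_injective

/-! ### The covering numbers -/

lemma exists_orientation (G : SimpleGraph V) : ∃ D : Digraph V, IsOrientation D G := by
  refine ⟨⟨fun u v => G.Adj u v ∧ WellOrderingRel u v⟩, fun u v => ⟨fun h => ?_, ?_⟩, ?_⟩
  · rcases trichotomous_of WellOrderingRel u v with h' | h' | h'
    · exact Or.inl ⟨h, h'⟩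
    · exact (h.ne h').elim
    · exact Or.inr ⟨h.symm, h'⟩
  · rintro (h | h)
    · exact h.1
    · exact h.1.symm
  · rintro u v ⟨_, h⟩ ⟨_, h'⟩
    exact asymm_of WellOrderingRel h h'

lemma exists_pseudoforest_cover_pseudoarboricity [Finite V] (G : SimpleGraph V) :
    ∃ H : Fin (pseudoarboricity G) → G.Subgraph, IsInjectiveCover Pseudoforest G H := by
  obtain ⟨D, hD⟩ := exists_orientation G
  exact Nat.sInf_mem (s := {k | ∃ H : Fin k → G.Subgraph, IsInjectiveCover Pseudoforest G H})
    ⟨_, exists_pseudoforest_cover_of_orientation hD fun _ => Set.ncard_le_card _⟩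

lemma exists_starForest_cover_localStarArboricity [Finite V] (G : SimpleGraph V) :
    ∃ (n : ℕ) (H : Fin n → G.Subgraph), IsInjectiveCover StarForest G H ∧
      ∀ v, {i | v ∈ (H i).verts}.ncard ≤ localStarArboricity G := by
  obtain ⟨D, hD⟩ := exists_orientation G
  have hlt : ∀ v, outDegree D v < Nat.card V + 1 := fun v => Nat.lt_succ_of_le (Set.ncard_le_card _)
  exact Nat.sInf_mem (s := {j | ∃ (n : ℕ) (H : Fin n → G.Subgraph),
    IsInjectiveCover StarForest G H ∧ ∀ v, {i | v ∈ (H i).verts}.ncard ≤ j})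
    ⟨_, exists_starForest_cover_of_orientation hD (fun v => (hlt v).le)
      fun v h => ((hlt v).ne h).elim⟩

lemma exists_forest_cover_arboricity [Finite V] (G : SimpleGraph V) :
    ∃ H : Fin (arboricity G) → G.Subgraph, IsInjectiveCover Forest G H := by
  obtain ⟨n, H, hH, hk⟩ := exists_starForest_cover_localStarArboricity G
  exact Nat.sInf_mem (s := {k | ∃ H : Fin k → G.Subgraph, IsInjectiveCover Forest G H})
    ⟨_, exists_forest_cover_of_starForest_cover hH hk⟩

lemma pseudoarboricity_le_of_orientation [Finite V] {G : SimpleGraph V} {D : Digraph V}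
    (hD : IsOrientation D G) {k : ℕ} (hk : ∀ v, outDegree D v ≤ k) : pseudoarboricity G ≤ k :=
  Nat.sInf_le (exists_pseudoforest_cover_of_orientation hD hk)

lemma localStarArboricity_le_of_orientation [Finite V] {G : SimpleGraph V} {D : Digraph V}
    (hD : IsOrientation D G) {k : ℕ} (hk : ∀ v, outDegree D v ≤ k)
    (hk' : ∀ v, outDegree D v = k → (G.neighborSet v).ncard = k) : localStarArboricity G ≤ k :=
  Nat.sInf_le (exists_starForest_cover_of_orientation hD hk hk')

lemma pseudoarboricity_le_arboricity [Finite V] (G : SimpleGraph V) :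
    pseudoarboricity G ≤ arboricity G := by
  obtain ⟨H, hH⟩ := exists_forest_cover_arboricity G
  exact Nat.sInf_le ⟨H, fun i => Forest.pseudoforest (hH.1 i), hH.2⟩

lemma arboricity_le_localStarArboricity [Finite V] (G : SimpleGraph V) :
    arboricity G ≤ localStarArboricity G := by
  obtain ⟨n, H, hH, hk⟩ := exists_starForest_cover_localStarArboricity G
  exact Nat.sInf_le (exists_forest_cover_of_starForest_cover hH hk)

lemma localStarArboricity_le_pseudoarboricity_add_one [Finite V] (G : SimpleGraph V) :
    localStarArboricity G ≤ pseudoarboricity G + 1 := by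
  obtain ⟨H, hH⟩ := exists_pseudoforest_cover_pseudoarboricity G
  obtain ⟨D, hD, hk⟩ := exists_orientation_of_pseudoforest_cover hH
  exact localStarArboricity_le_of_orientation hD (fun v => Nat.le_succ_of_le (hk v))
    fun v h => (Nat.not_succ_le_self _ (h ▸ hk v)).elim

lemma outDegree_le_maxOutDegree [Fintype V] (D : Digraph V) (v : V) :
    outDegree D v ≤ maxOutDegree D := Finset.le_sup (Finset.mem_univ v)

lemma localStarArboricity_eq_pseudoarboricity_iff [Fintype V] (G : SimpleGraph V) :
    localStarArboricity G = pseudoarboricity G ↔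
      ∃ D : Digraph V, IsOrientation D G ∧ maxOutDegree D = pseudoarboricity G ∧
        ∀ v, outDegree D v = pseudoarboricity G →
          (G.neighborSet v).ncard = pseudoarboricity G := by
  constructor
  · intro h
    obtain ⟨n, H, hH, hk⟩ := exists_starForest_cover_localStarArboricity G
    rw [h] at hk
    obtain ⟨D, hD, hle, hdeg⟩ := exists_orientation_of_starForest_cover hH hk
    exact ⟨D, hD, le_antisymm (Finset.sup_le fun v _ => hle v)
      (pseudoarboricity_le_of_orientation hD (outDegree_le_maxOutDegree D)), hdeg⟩
  · rintro ⟨D, hD, hmax, hdeg⟩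
    exact le_antisymm
      (localStarArboricity_le_of_orientation hD (fun v => hmax ▸ outDegree_le_maxOutDegree D v)
        hdeg)
      ((pseudoarboricity_le_arboricity G).trans (arboricity_le_localStarArboricity G))

/-! ### Strictness -/

/-- The triangle is a pseudoforest but not a forest. -/
lemma pseudoarboricity_lt_arboricity_triangle :
    pseudoarboricity (⊤ : SimpleGraph (Fin 3)) < arboricity (⊤ : SimpleGraph (Fin 3)) := by
  have hp : pseudoarboricity (⊤ : SimpleGraph (Fin 3)) ≤ 1 := by
    refine pseudoarboricity_le_of_orientation (D := ⟨fun u v => v = u + 1⟩) ⟨?_, ?_⟩ fun v => ?_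
    · simp only [top_adj]
      decide
    · simp only
      decide
    · exact (Set.ncard_singleton (v + 1)).le
  refine hp.trans_lt ?_
  by_contra! ha
  obtain ⟨H, hH, hcov⟩ := exists_forest_cover_arboricity (⊤ : SimpleGraph (Fin 3))
  have := Fin.subsingleton_iff_le_one.2 ha
  obtain ⟨i, h01⟩ := hcov 0 1 (by simp)
  have h12 : (H i).Adj 1 2 := by
    obtain ⟨j, h⟩ := hcov 1 2 (by simp)
    rwa [Subsingleton.elim i j]
  have h20 : (H i).Adj 2 0 := by
    obtain ⟨j, h⟩ := hcov 2 0 (by simp)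
    rwa [Subsingleton.elim i j]
  refine hH i (Walk.cons h01.coe (Walk.cons h12.coe (Walk.cons h20.coe Walk.nil))) ?_
  simp [Walk.cons_isCycle_iff]

/-- The path with three edges is a forest. In an orientation, its middle edge leaves a vertex of
degree `2`. -/
lemma arboricity_lt_localStarArboricity_pathGraph :
    arboricity (pathGraph 4) < localStarArboricity (pathGraph 4) := by
  have ha : arboricity (pathGraph 4) ≤ 1 := by
    refine Nat.sInf_le ⟨fun _ => ⊤, fun _ => ?_, fun u v h => ⟨0, h⟩⟩
    refine IsAcyclic.subgraph ?_ _
    let D : Digraph (Fin 4) := ⟨fun u v => u.val + 1 = v.val⟩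
    have hD : IsOrientation D (pathGraph 4) :=
      ⟨fun u v => pathGraph_adj, fun u v h h' => by simp only [D] at h h'; lia⟩
    have hf : IsFunctional D := fun u v w h h' => Fin.ext (h.symm.trans h')
    intro v c
    exact hf.not_isCycle_of_reachable hD (a := 3) (fun x h => by simp only [D] at h; lia)
      ((pathGraph_connected 3).preconnected v 3) c
  refine ha.trans_lt ?_
  by_contra! hs
  obtain ⟨n, H, hH, hk⟩ := exists_starForest_cover_localStarArboricity (pathGraph 4)
  obtain ⟨D, hD, hle, hdeg⟩ := exists_orientation_of_starForest_cover hH hk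
  have key : ∀ u v a b, D.Adj u v → a ≠ b → (pathGraph 4).Adj u a → (pathGraph 4).Adj u b →
      False := by
    intro u v a b huv hab ha hb
    have h1 : 0 < outDegree D u := (Set.ncard_pos (Set.toFinite _)).2 ⟨v, huv⟩
    have h2 := hdeg u (by have := hle u; lia)
    have h3 : 1 < ((pathGraph 4).neighborSet u).ncard :=
      (Set.one_lt_ncard (Set.toFinite _)).2 ⟨a, ha, b, hb, hab⟩
    lia
  have h12 : (pathGraph 4).Adj 1 2 := by simp [pathGraph_adj]
  rcases (hD.1 1 2).1 h12 with h | h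
  · exact key 1 2 0 2 h (by decide) (by simp [pathGraph_adj]) h12
  · exact key 2 1 1 3 h (by decide) h12.symm (by simp [pathGraph_adj])

/-- A single edge is a star, and covering it takes at least one subgraph. -/
lemma localStarArboricity_lt_pseudoarboricity_add_one_edge :
    localStarArboricity (⊤ : SimpleGraph (Fin 2)) <
      pseudoarboricity (⊤ : SimpleGraph (Fin 2)) + 1 := by
  have hs : localStarArboricity (⊤ : SimpleGraph (Fin 2)) ≤ 1 := by
    refine Nat.sInf_le ⟨1, fun _ => ⊤, ⟨fun _ => ?_, fun u v h => ⟨0, h⟩⟩, fun v => ?_⟩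
    · refine starForest_of_center (c := 0) fun u v h => ?_
      have : u ≠ v := h.ne
      lia
    · simp
  obtain ⟨H, -, hcov⟩ := exists_pseudoforest_cover_pseudoarboricity (⊤ : SimpleGraph (Fin 2))
  obtain ⟨i, -⟩ := hcov 0 1 (by simp)
  have := i.pos
  lia

end GraphCover

theorem mainTheorem1 :
    (∀ {V : Type u} [Fintype V] (G : SimpleGraph V) [DecidableRel G.Adj],
      GraphCover.pseudoarboricity G ≤ GraphCover.arboricity G ∧
      GraphCover.arboricity G ≤ GraphCover.localStarArboricity G ∧
      GraphCover.localStarArboricity G ≤ GraphCover.pseudoarboricity G + 1 ∧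
      (GraphCover.localStarArboricity G = GraphCover.pseudoarboricity G ↔
        ∃ D : Digraph V, GraphCover.IsOrientation D G ∧
          GraphCover.maxOutDegree D = GraphCover.pseudoarboricity G ∧
          ∀ v, GraphCover.outDegree D v = GraphCover.pseudoarboricity G →
            G.degree v = GraphCover.pseudoarboricity G)) ∧
    (∃ (n : ℕ) (G : SimpleGraph (Fin n)),
      GraphCover.pseudoarboricity G < GraphCover.arboricity G) ∧
    (∃ (n : ℕ) (G : SimpleGraph (Fin n)),
      GraphCover.arboricity G < GraphCover.localStarArboricity G) ∧
    (∃ (n : ℕ) (G : SimpleGraph (Fin n)),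
      GraphCover.localStarArboricity G < GraphCover.pseudoarboricity G + 1) := by
  refine ⟨fun {V} _ G _ => ⟨GraphCover.pseudoarboricity_le_arboricity G,
    GraphCover.arboricity_le_localStarArboricity G,
    GraphCover.localStarArboricity_le_pseudoarboricity_add_one G, ?_⟩,
    ⟨3, ⊤, GraphCover.pseudoarboricity_lt_arboricity_triangle⟩,
    ⟨4, _, GraphCover.arboricity_lt_localStarArboricity_pathGraph⟩,
    ⟨2, ⊤, GraphCover.localStarArboricity_lt_pseudoarboricity_add_one_edge⟩⟩
  have hdeg : ∀ v, G.degree v = (G.neighborSet v).ncard := fun v => by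
    rw [← SimpleGraph.card_neighborSet_eq_degree, ← Nat.card_eq_fintype_card,
      Nat.card_coe_set_eq]
  simp only [hdeg]
  exact GraphCover.localStarArboricity_eq_pseudoarboricity_iff G
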